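/- Let $P=(V_1,\dots,V_n)$ be an oriented closed polygon on the unit sphere $S^2\subset\mathbb R^3$: consecutive vertices $V_i,V_{i+1}$ (index cyclic) are neither equal nor antipodal, and the $i$-th side is the minor geodesic arc from $V_i$ to $V_{i+1}$. Self-intersections are allowed. Circumcenter of mass. Let $W\in S^2$ be distinct from all vertices of $P$. Let $O_i\in S^2$ be the circumcenter of the oriented triangle $WV_iV_{i+1}$, that is, the one of the two antipodal centers of the circle through $W,V_i,V_{i+1}$ that the right-hand rule chooses, and let $m_i$ be the area of the plane triangle $WV_iV_{i+1}$. Then $CCM(P)$ is the vector $\sum_i m_iO_i$ normalized to be unit. Center of mass of the lamina. If $P$ is simple and $U\subset S^2$ is the domain bounded by $P$ that lies to the left of the sides (seen from outside of the sphere), then $CM(P)$ is the vector $\int_U v\,dA$ normalized to be unit, where $dA$ is the area form of $S^2$. In general, the lamina bounded by $P$ is given by an integer multiplicity function $m$ on $S^2$ that is locally constant off the curve $P$ and increases by the net number of sides that are crossed when one crosses $P$ from right to left at a generic point of $P$ (for simple $P$, the indicator function of $U$ is such a function); then $CM(P)$ is the vector $\int_{S^2} m(v)\,v\,dA$ normalized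 to be unit. Theorem. If all sides of $P$ have the same spherical length, then for every such $W$, and for the domain $U$ (if $P$ is simple) as well as for every multiplicity function $m$ of the lamina, the vector $\sum_i m_iO_i$ vanishes if and only if the vector defining $CM(P)$ vanishes, and otherwise $$CCM(P)=CM(P).$$ -/

import Mathlib

open scoped Topology RealInnerProductSpace

namespace SphericalPolygon

noncomputable section

/-- Euclidean three-space. -/
abbrev E3 : Type := EuclideanSpace ℝ (Fin 3)

/-- The unit sphere in Euclidean three-space. -/
abbrev S2 : Type := Metric.sphere (0 : E3) 1

/-- The cross product of two vectors of Euclidean three-space. -/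
def cross (a b : E3) : E3 :=
  WithLp.toLp 2 (crossProduct (WithLp.ofLp a) (WithLp.ofLp b))

/-- The standard area measure on the unit sphere (of total mass `4 * π`). -/
def area : MeasureTheory.Measure S2 :=
  (MeasureTheory.volume : MeasureTheory.Measure E3).toSphere

/-- The minor geodesic arc from `A` to `B`, endpoints included, for `B` not antipodal to `A`:
the points of the sphere in the convex cone spanned by `A` and `B`. -/
def arc (A B : S2) : Set S2 :=
  {p | ∃ s t : ℝ, 0 ≤ s ∧ 0 ≤ t ∧ (p : E3) = s • (A : E3) + t • (B : E3)}

/-- The center of the circle through the points `A, B, C` of the sphere (assumed distinct),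
oriented by the cyclic order `A, B, C`; of the two antipodal centers the right-hand rule chooses
the unit normal of the oriented plane `ABC`. See `dist_circumcenter` and
`circumcenter_right_hand` below. -/
def circumcenter (A B C : S2) : E3 :=
  NormedSpace.normalize (cross ((B : E3) - A) ((C : E3) - A))

/-- The area of the plane triangle `ABC` in space: half the product of two sides and the sine of
the angle between them. -/
def planeTriangleArea (A B C : E3) : ℝ :=
  1 / 2 * dist A B * dist A C * Real.sin (EuclideanGeometry.angle B A C)

/-- The vector `∑ mᵢ Oᵢ` of a finite system of points `Oᵢ` with masses `mᵢ`. -/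
def moment {n : ℕ} (O : Fin n → E3) (m : Fin n → ℝ) : E3 := ∑ i, m i • O i

/-- The center of mass of a system of masses on the sphere: the vector `∑ mᵢ Oᵢ`
normalized to be unit (and the value `0` where that vector vanishes, so that there is no center). -/
def centerOfMass {n : ℕ} (O : Fin n → E3) (m : Fin n → ℝ) : E3 :=
  NormedSpace.normalize (moment O m)

section Polygon

variable {n : ℕ} [NeZero n]

/-- A cyclic sequence of points of the sphere is a polygon if consecutive vertices are neither
equal nor antipodal, so that they span a side, the minor arc between them. The index is cyclic:
in `Fin n` the successor of the last index is `0`. -/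
def IsPolygon (V : Fin n → S2) : Prop :=
  ∀ i, (V (i + 1) : E3) ≠ V i ∧ (V (i + 1) : E3) ≠ -(V i : E3)

/-- The `i`-th side of the polygon. -/
def side (V : Fin n → S2) (i : Fin n) : Set S2 := arc (V i) (V (i + 1))

/-- The spherical length of the `i`-th side: the angle between its endpoints. -/
def sideLength (V : Fin n → S2) (i : Fin n) : ℝ :=
  InnerProductGeometry.angle (V i : E3) (V (i + 1) : E3)

/-- All sides have the same spherical length. -/
def IsEquilateral (V : Fin n → S2) : Prop := ∀ i j, sideLength V i = sideLength V j

/-- The closed curve formed by the sides. -/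
def trace (V : Fin n → S2) : Set S2 := ⋃ i, side V i

/-- The normal of the plane of the `i`-th side, pointing to the left of the side (seen from
outside of the sphere) when it is traversed from `V i` to `V (i + 1)`. -/
def leftNormal (V : Fin n → S2) (i : Fin n) : E3 := cross (V i) (V (i + 1))

/-- The vector `∑ mᵢ Oᵢ`, where `Oᵢ` is the circumcenter of the oriented triangle `W Vᵢ Vᵢ₊₁` and
`mᵢ` is the area of the plane triangle with these vertices. -/
def ccmMoment (V : Fin n → S2) (W : S2) : E3 :=
  moment (fun i => circumcenter W (V i) (V (i + 1)))
    (fun i => planeTriangleArea (W : E3) (V i) (V (i + 1)))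

/-- The circumcenter of mass of the polygon, constructed from the auxiliary point `W`: the center
of mass of the circumcenters of the triangles `W Vᵢ Vᵢ₊₁`, taken with the areas of the plane
triangles `W Vᵢ Vᵢ₊₁` as masses. -/
def CCM (V : Fin n → S2) (W : S2) : E3 :=
  centerOfMass (fun i => circumcenter W (V i) (V (i + 1)))
    (fun i => planeTriangleArea (W : E3) (V i) (V (i + 1)))

/-- A simple polygon: two different sides meet at most in a common endpoint of consecutive sides. -/
def IsSimple (V : Fin n → S2) : Prop :=
  ∀ i j p, i ≠ j → p ∈ side V i → p ∈ side V j →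
    (j = i + 1 ∧ p = V (i + 1)) ∨ (i = j + 1 ∧ p = V i)

/-- `U` is the open domain of the sphere bounded by the oriented polygon `V`: its boundary is the
curve, and near each point of a side that is not a vertex, `U` is the part of the sphere to the
left of the side. -/
structure IsDomainBoundedBy (V : Fin n → S2) (U : Set S2) : Prop where
  isOpen : IsOpen U
  frontier_eq : frontier U = trace V
  left : ∀ i, ∀ p ∈ side V i, (∀ j, p ≠ V j) →
    ∀ᶠ q : S2 in 𝓝 p, (q ∈ U ↔ 0 < ⟪leftNormal V i, (q : E3)⟫)

open scoped Classical in
/-- The number of sides through `p` that run in the direction of the `i`-th side minus the number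
of those that run in the opposite direction. (It is used where all sides through `p` lie in the
great circle of the `i`-th side.) -/
def netMultiplicity (V : Fin n → S2) (i : Fin n) (p : S2) : ℤ :=
  ∑ j, if p ∈ side V j then (SignType.sign ⟪leftNormal V i, leftNormal V j⟫ : ℤ) else 0

/-- `m` is the multiplicity function of the lamina bounded by the oriented, possibly
self-intersecting polygon `V`, that is, a function whose value at a point off the curve is the
number of times, counted with sign, that the lamina covers this point. It is locally constant off
the curve, and it increases by the net number of sides that are crossed when one crosses the curve
from right to left at a point which is not a vertex and at which no two sides cross transversally.
This determines `m` off the curve up to an additive constant. For a simple polygon the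
multiplicity function of the domain to the left is its indicator function. -/
structure IsLaminaBoundedBy (V : Fin n → S2) (m : S2 → ℤ) : Prop where
  locallyConst : ∀ p ∉ trace V, ∀ᶠ q : S2 in 𝓝 p, m q = m p
  jump : ∀ i, ∀ p ∈ side V i, (∀ j, p ≠ V j) →
    (∀ j, p ∈ side V j → cross (leftNormal V i) (leftNormal V j) = 0) →
    ∀ᶠ q : S2 × S2 in 𝓝 (p, p),
      0 < ⟪leftNormal V i, (q.1 : E3)⟫ → ⟪leftNormal V i, (q.2 : E3)⟫ < 0 →
        m q.1 - m q.2 = netMultiplicity V i p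

end Polygon

/-- The vector `∫_U v dA` of a spherical domain. -/
def domainMoment (U : Set S2) : E3 := ∫ v in U, (v : E3) ∂area

/-- The center of mass of a spherical domain: the vector `∫_U v dA` normalized to be unit. -/
def domainCM (U : Set S2) : E3 := NormedSpace.normalize (domainMoment U)

/-- The vector `∫ m(v) v dA` of a lamina with multiplicity function `m`. -/
def laminaMoment (m : S2 → ℤ) : E3 := ∫ v, (m v : ℝ) • (v : E3) ∂area

/-- The center of mass of a lamina with multiplicity function `m`. -/
def laminaCM (m : S2 → ℤ) : E3 := NormedSpace.normalize (laminaMoment m)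

/-- The circumcenter is equidistant from the three vertices. -/
theorem dist_circumcenter (A B C : S2) :
    dist (circumcenter A B C) B = dist (circumcenter A B C) A ∧
      dist (circumcenter A B C) C = dist (circumcenter A B C) A := by
  have key : ∀ X Y : S2, ∀ O : E3, ⟪O, (X : E3) - Y⟫ = 0 → dist O X = dist O Y := by
    intro X Y O h
    have hX : ‖(X : E3)‖ = 1 := norm_eq_of_mem_sphere X
    have hY : ‖(Y : E3)‖ = 1 := norm_eq_of_mem_sphere Y
    rw [inner_sub_right] at h
    rw [dist_eq_norm, dist_eq_norm, ← sq_eq_sq₀ (norm_nonneg _) (norm_nonneg _),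
      norm_sub_sq_real, norm_sub_sq_real, hX, hY]
    linarith
  constructor <;> apply key <;>
    simp only [circumcenter, NormedSpace.normalize, inner_smul_left, cross, cross_apply,
      PiLp.inner_apply, Fin.sum_univ_three] <;> simp <;> right <;> ring

/-- The circumcenter of a non-degenerate triangle is the center for which the vertices
`A, B, C` are in positive cyclic order. -/
theorem circumcenter_right_hand (A B C : S2) (h : cross ((B : E3) - A) ((C : E3) - A) ≠ 0) :
    ‖circumcenter A B C‖ = 1 ∧
      0 < ⟪cross ((B : E3) - A) ((C : E3) - A), circumcenter A B C⟫ := by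
  refine ⟨NormedSpace.norm_normalize_eq_one_iff.2 h, ?_⟩
  have := norm_pos_iff.2 h
  rw [circumcenter, NormedSpace.normalize, inner_smul_right, real_inner_self_eq_norm_sq]
  positivity

end

end SphericalPolygon

open scoped Topology RealInnerProductSpace Pointwise
open MeasureTheory Set Filter

namespace SphericalPolygon

noncomputable section

/-! Each weighted circumcenter `mᵢ Oᵢ` is half the cross product of `Vᵢ - W` and `Vᵢ₊₁ - W`. In the
cyclic sum the terms with `W` cancel, so the circumcenter moment is half the sum of the side normals
`Vᵢ × Vᵢ₊₁` (`ccmMoment_eq`). It remains to show that the lamina moment is a positive multiple of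
the same sum.

For `v` off the great circles of the sides, project the polygon to the tangent plane at `v`. Its
winding number about the origin is the sum of the signed angles at which the sides are seen, divided
by `2π`. The projection kills both `v` and `-v`, so this number jumps across the polygon and across
its antipodal image, exactly as `m(v) - m(-v)` does. Hence the two differ by a constant
(`exists_defect_eq`). Integrated against `v`, the constant disappears and `m(v) - m(-v)` gives twice
the lamina moment, which is thus a sum of contributions of single sides (`laminaMoment_eq_sum`). By
symmetry each contribution is a positive multiple of the normal of the side, with a factor depending
only on the length (`exists_subtendMoment_eq`). For equal lengths the factor comes out of the sum. A
simple domain is the case of an indicator function. -/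

/-! ### Cross products and the moment of the circumcenters. -/

lemma inner_eq (x y : E3) : ⟪x, y⟫ = x 0 * y 0 + x 1 * y 1 + x 2 * y 2 := by
  simp only [PiLp.inner_apply, Fin.sum_univ_three]
  simp [mul_comm]

@[simp] lemma cross_zero (a b : E3) : cross a b 0 = a 1 * b 2 - a 2 * b 1 := by
  simp [cross, cross_apply]

@[simp] lemma cross_one (a b : E3) : cross a b 1 = a 2 * b 0 - a 0 * b 2 := by
  simp [cross, cross_apply]

@[simp] lemma cross_two (a b : E3) : cross a b 2 = a 0 * b 1 - a 1 * b 0 := by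
  simp [cross, cross_apply]

lemma ext_coord {x y : E3} (h0 : x 0 = y 0) (h1 : x 1 = y 1) (h2 : x 2 = y 2) : x = y := by
  ext i
  fin_cases i
  exacts [h0, h1, h2]

lemma inner_self_sphere (v : S2) : ⟪(v : E3), (v : E3)⟫ = 1 := by
  rw [real_inner_self_eq_norm_sq, norm_eq_of_mem_sphere, one_pow]

lemma inner_cross_left (a b : E3) : ⟪cross a b, a⟫ = 0 := by
  rw [inner_eq, cross_zero, cross_one, cross_two]
  ring

lemma inner_cross_right (a b : E3) : ⟪cross a b, b⟫ = 0 := by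
  rw [inner_eq, cross_zero, cross_one, cross_two]
  ring

lemma inner_cross_cross (a b : E3) :
    ⟪cross a b, cross a b⟫ = ⟪a, a⟫ * ⟪b, b⟫ - ⟪a, b⟫ ^ 2 := by
  simp only [inner_eq, cross_zero, cross_one, cross_two]
  ring

lemma cross_sub_sub (w a b : E3) :
    cross (a - w) (b - w) = cross a b - (cross w b - cross w a) := by
  apply ext_coord <;> simp <;> ring

/-- The inner products of consecutive vertices on the sphere lie strictly between `-1` and `1`. -/
lemma inner_sq_lt_one {A B : S2} (h1 : (B : E3) ≠ A) (h2 : (B : E3) ≠ -(A : E3)) :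
    ⟪(A : E3), (B : E3)⟫ ^ 2 < 1 := by
  have hA := inner_self_sphere A
  have hB := inner_self_sphere B
  have e1 : 0 < ⟪(B : E3) - A, (B : E3) - A⟫ := real_inner_self_pos.2 (sub_ne_zero.2 h1)
  have e2 : 0 < ⟪(B : E3) + A, (B : E3) + A⟫ :=
    real_inner_self_pos.2 fun h => h2 (eq_neg_of_add_eq_zero_left h)
  rw [real_inner_sub_sub_self, real_inner_comm (A : E3) (B : E3)] at e1
  rw [real_inner_add_add_self, real_inner_comm (A : E3) (B : E3)] at e2
  nlinarith

lemma cross_ne_zero {A B : S2} (h : ⟪(A : E3), (B : E3)⟫ ^ 2 < 1) : cross A B ≠ 0 := by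
  rw [← inner_self_ne_zero (𝕜 := ℝ), inner_cross_cross, inner_self_sphere, inner_self_sphere]
  linarith

lemma norm_cross (x y : E3) :
    ‖cross x y‖ = Real.sin (InnerProductGeometry.angle x y) * (‖x‖ * ‖y‖) := by
  rw [InnerProductGeometry.sin_angle_mul_norm_mul_norm, ← sq, ← inner_cross_cross,
    real_inner_self_eq_norm_sq, Real.sqrt_sq (norm_nonneg _)]

/-- The area is half the norm of the cross product that the circumcenter normalizes. For a
degenerate triangle both sides vanish. -/
lemma area_smul_circumcenter (A B C : S2) :
    planeTriangleArea (A : E3) B C • circumcenter A B C =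
      (1 / 2 : ℝ) • cross ((B : E3) - A) ((C : E3) - A) := by
  have h : planeTriangleArea (A : E3) B C = 1 / 2 * ‖cross ((B : E3) - A) ((C : E3) - A)‖ := by
    rw [norm_cross, planeTriangleArea, EuclideanGeometry.angle, vsub_eq_sub, vsub_eq_sub,
      dist_comm (A : E3), dist_comm (A : E3), dist_eq_norm, dist_eq_norm]
    ring
  rw [h, mul_smul, circumcenter, NormedSpace.norm_smul_normalize]

/-- The moment of the circumcenters does not depend on the auxiliary point. -/
lemma ccmMoment_eq {n : ℕ} [NeZero n] (V : Fin n → S2) (W : S2) :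
    ccmMoment V W = (1 / 2 : ℝ) • ∑ i, leftNormal V i := by
  rw [ccmMoment, moment, Finset.smul_sum]
  simp only [area_smul_circumcenter, cross_sub_sub, smul_sub, Finset.sum_sub_distrib, leftNormal]
  -- The cyclic shift of the index makes the two sums involving `W` equal.
  rw [show ∑ i, (1 / 2 : ℝ) • cross (W : E3) (V (i + 1)) = ∑ i, (1 / 2 : ℝ) • cross (W : E3) (V i)
    from Equiv.sum_comp (Equiv.addRight (1 : Fin n)) fun i => (1 / 2 : ℝ) • cross (W : E3) (V i),
    sub_self, sub_zero]

/-! ### The area measure -/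

instance : IsFiniteMeasure area := by unfold area; infer_instance

/-- The action of a linear isometry on the sphere. -/
def sphereMap (R : E3 ≃ₗᵢ[ℝ] E3) : S2 ≃ₜ S2 where
  toFun v := ⟨R v, by simp⟩
  invFun v := ⟨R.symm v, by simp⟩
  left_inv v := by simp
  right_inv v := by simp
  continuous_toFun := by fun_prop
  continuous_invFun := by fun_prop

@[simp] lemma coe_sphereMap (R : E3 ≃ₗᵢ[ℝ] E3) (v : S2) : (sphereMap R v : E3) = R v := rfl

/-- `toSphere` measures a set by the volume of the cone over it, and `R` carries cones to cones and
preserves volume. -/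
lemma measurePreserving_sphereMap (R : E3 ≃ₗᵢ[ℝ] E3) :
    MeasurePreserving (sphereMap R) area area := by
  refine ⟨(sphereMap R).continuous.measurable, ?_⟩
  ext s hs
  have hm := (sphereMap R).continuous.measurable hs
  rw [Measure.map_apply (sphereMap R).continuous.measurable hs, area,
    Measure.toSphere_apply' _ hm, Measure.toSphere_apply' _ hs]
  congr 1
  have h : Ioo (0 : ℝ) 1 • ((↑) '' (sphereMap R ⁻¹' s) : Set E3) =
      R ⁻¹' (Ioo (0 : ℝ) 1 • ((↑) '' s : Set E3)) := by
    ext x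
    simp only [Set.mem_smul, mem_image, mem_preimage]
    constructor
    · rintro ⟨r, hr, _, ⟨v, hv, rfl⟩, rfl⟩
      exact ⟨r, hr, _, ⟨_, hv, rfl⟩, by simp⟩
    · rintro ⟨r, hr, _, ⟨v, hv, rfl⟩, h⟩
      refine ⟨r, hr, _, ⟨(sphereMap R).symm v, by simpa using hv, rfl⟩, ?_⟩
      apply R.injective
      rw [← h, map_smul, ← coe_sphereMap, Homeomorph.apply_symm_apply]
  rw [h]
  exact R.measurePreserving.measure_preimage_equiv (f := R.toMeasurableEquiv) _

lemma integral_sphereMap (R : E3 ≃ₗᵢ[ℝ] E3) (f : S2 → E3) :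
    ∫ v, f (sphereMap R v) ∂area = ∫ v, f v ∂area :=
  (measurePreserving_sphereMap R).integral_comp (sphereMap R).measurableEmbedding f

lemma integral_neg_sphere (f : S2 → E3) : ∫ v, f (-v) ∂area = ∫ v, f v ∂area := by
  rw [← integral_sphereMap (LinearIsometryEquiv.neg ℝ) f]
  congr 1

/-- The cone over a great circle lies in a plane, which has volume zero. -/
lemma ae_inner_ne_zero {n : E3} (hn : n ≠ 0) : ∀ᵐ v : S2 ∂area, ⟪n, (v : E3)⟫ ≠ 0 := by
  have hm : MeasurableSet {v : S2 | ⟪n, (v : E3)⟫ = 0} :=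
    (isClosed_eq (by fun_prop) continuous_const).measurableSet
  have : area {v : S2 | ⟪n, (v : E3)⟫ = 0} = 0 := by
    rw [area, Measure.toSphere_apply' _ hm]
    refine mul_eq_zero_of_right _ (measure_mono_null (t := ((ℝ ∙ n)ᗮ : Submodule ℝ E3)) ?_ ?_)
    · rintro _ ⟨r, hr, _, ⟨v, hv, rfl⟩, rfl⟩
      simp only [SetLike.mem_coe, Submodule.mem_orthogonal_singleton_iff_inner_right]
      exact (inner_smul_right _ _ _).trans (mul_eq_zero_of_right _ hv)
    · apply Measure.addHaar_submodule
      intro h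
      have : n ∈ (ℝ ∙ n)ᗮ := h ▸ Submodule.mem_top
      rw [Submodule.mem_orthogonal_singleton_iff_inner_right] at this
      exact hn (inner_self_eq_zero.1 this)
  rw [ae_iff]
  simpa using this

lemma area_ne_zero : area ≠ 0 := Measure.toSphere_ne_zero _

/-! ### The angle subtended by an arc -/

/-- The complex number whose argument is the angle at which the arc from `A` to `B` is seen from
the point `v` of the sphere. -/
def subtend (A B v : E3) : ℂ := ⟨⟪A, B⟫ - ⟪A, v⟫ * ⟪B, v⟫, ⟪cross A B, v⟫⟩

/-- Identify the tangent plane at `v` with `ℂ` and let `r`, `a`, `b` be the projections of `R`, `A`,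
`B`. Then `subtend A B v` is `conj a * b`, and the real factor is `|r|²`. -/
lemma conj_subtend_mul (R A B v : E3) (hv : ⟪v, v⟫ = 1) :
    (starRingEnd ℂ) (subtend R A v) * subtend R B v =
      ((⟪R, R⟫ - ⟪R, v⟫ ^ 2 : ℝ) : ℂ) * subtend A B v := by
  apply Complex.ext
  · simp only [subtend, Complex.mul_re, Complex.conj_re, Complex.conj_im, Complex.ofReal_re,
      Complex.ofReal_im]
    simp only [inner_eq, cross_zero, cross_one, cross_two] at hv ⊢
    linear_combination ((R 0 * R 0 + R 1 * R 1 + R 2 * R 2) * (A 0 * B 0 + A 1 * B 1 + A 2 * B 2) -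
      (R 0 * A 0 + R 1 * A 1 + R 2 * A 2) * (R 0 * B 0 + R 1 * B 1 + R 2 * B 2)) * hv
  · simp only [subtend, Complex.mul_im, Complex.conj_re, Complex.conj_im, Complex.ofReal_re,
      Complex.ofReal_im]
    simp only [inner_eq, cross_zero, cross_one, cross_two] at hv ⊢
    linear_combination ((R 0 * R 0 + R 1 * R 1 + R 2 * R 2) *
      ((A 1 * B 2 - A 2 * B 1) * v 0 + (A 2 * B 0 - A 0 * B 2) * v 1 +
        (A 0 * B 1 - A 1 * B 0) * v 2) -
      (R 0 * A 0 + R 1 * A 1 + R 2 * A 2) * ((R 1 * B 2 - R 2 * B 1) * v 0 +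
        (R 2 * B 0 - R 0 * B 2) * v 1 + (R 0 * B 1 - R 1 * B 0) * v 2) +
      (R 0 * B 0 + R 1 * B 1 + R 2 * B 2) * ((R 1 * A 2 - R 2 * A 1) * v 0 +
        (R 2 * A 0 - R 0 * A 2) * v 1 + (R 0 * A 1 - R 1 * A 0) * v 2)) * hv

lemma inner_sq_lt_one_of_cross {A B v : S2} (h : ⟪cross (A : E3) B, (v : E3)⟫ ≠ 0) :
    ⟪(A : E3), (v : E3)⟫ ^ 2 < 1 := by
  have h1 : cross (A : E3) v ≠ 0 := by
    intro h0
    apply h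
    have : ⟪cross (A : E3) B, (v : E3)⟫ = -⟪cross (A : E3) v, (B : E3)⟫ := by
      simp only [inner_eq, cross_zero, cross_one, cross_two]
      ring
    rw [this, h0, inner_zero_left, neg_zero]
  have h2 := real_inner_self_pos.2 h1
  rw [inner_cross_cross, inner_self_sphere, inner_self_sphere] at h2
  linarith

/-- Off the great circles of the sides, the total angle at which a closed polygon is seen is a
multiple of `2 * π`. -/
lemma sum_arg_subtend {n : ℕ} [NeZero n] (V : Fin n → S2) (v : S2)
    (h : ∀ i, ⟪leftNormal V i, (v : E3)⟫ ≠ 0) :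
    ∃ k : ℤ, ∑ i, (subtend (V i) (V (i + 1)) v).arg = 2 * Real.pi * k := by
  set a : Fin n → ℂ := fun i => subtend (V 0) (V i) v with ha
  have hr : 0 < ⟪(V 0 : E3), (V 0 : E3)⟫ - ⟪(V 0 : E3), (v : E3)⟫ ^ 2 := by
    rw [inner_self_sphere]
    linarith [inner_sq_lt_one_of_cross (h 0)]
  have hz : ∀ i, subtend (V i) (V (i + 1)) v ≠ 0 := fun i h0 => h i (congrArg Complex.im h0)
  have hmul := fun i => conj_subtend_mul (V 0) (V i) (V (i + 1)) v (inner_self_sphere v)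
  have ha0 : ∀ i, a i ≠ 0 := by
    intro i h0
    have h1 := hmul i
    rw [show subtend (V 0) (V i) v = 0 from h0, map_zero, zero_mul, eq_comm, mul_eq_zero] at h1
    exact h1.elim (fun h => hr.ne' (Complex.ofReal_eq_zero.1 h)) (hz i)
  -- Modulo `2π` each angle is a difference of directions measured from `V 0`, so the cyclic sum
  -- telescopes.
  have harg : ∀ i, ((subtend (V i) (V (i + 1)) v).arg : Real.Angle) =
      ((a (i + 1)).arg : Real.Angle) - (a i).arg := by
    intro i
    rw [← Complex.arg_real_mul _ hr, ← hmul i,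
      Complex.arg_mul_coe_angle ((map_ne_zero _).2 (ha0 i)) (ha0 (i + 1)),
      Complex.arg_conj_coe_angle, neg_add_eq_sub]
  have hsum : ((∑ i, (subtend (V i) (V (i + 1)) v).arg : ℝ) : Real.Angle) = 0 := by
    rw [← Real.Angle.coe_coeHom, map_sum]
    simp only [Real.Angle.coe_coeHom, harg, Finset.sum_sub_distrib]
    rw [sub_eq_zero]
    exact Equiv.sum_comp (Equiv.addRight (1 : Fin n)) fun i => ((a i).arg : Real.Angle)
  rw [← Real.Angle.coe_zero, Real.Angle.angle_eq_iff_two_pi_dvd_sub, sub_zero] at hsum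
  exact hsum

@[fun_prop]
lemma continuous_subtend (A B : E3) : Continuous (subtend A B) := by
  have : subtend A B = fun v => ((⟪A, B⟫ - ⟪A, v⟫ * ⟪B, v⟫ : ℝ) : ℂ) +
      ((⟪cross A B, v⟫ : ℝ) : ℂ) * Complex.I := by
    ext v
    rw [← Complex.mk_eq_add_mul_I, subtend]
  rw [this]
  fun_prop

lemma measurable_arg_subtend (A B : E3) :
    Measurable fun v : S2 => (subtend A B v).arg :=
  Complex.measurable_arg.comp ((continuous_subtend A B).comp continuous_subtype_val).measurable

/-! ### The contribution of one arc to the moment. -/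

lemma integrable_smul_coe {f : S2 → ℝ} (hf : AEStronglyMeasurable f area) (C : ℝ)
    (hC : ∀ᵐ v ∂area, |f v| ≤ C) : Integrable (fun v : S2 => f v • (v : E3)) area := by
  refine Integrable.of_bound
    (hf.smul continuous_subtype_val.aestronglyMeasurable) C ?_
  filter_upwards [hC] with v hv
  rw [norm_smul, norm_eq_of_mem_sphere, mul_one]
  exact hv

lemma integrable_arg_subtend (A B : E3) :
    Integrable (fun v : S2 => (subtend A B v).arg • (v : E3)) area :=
  integrable_smul_coe (measurable_arg_subtend A B).aestronglyMeasurable Real.pi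
    (Filter.Eventually.of_forall fun _ => Complex.abs_arg_le_pi _)

/-- The moment of the density given by the angle at which the arc from `A` to `B` is seen. -/
def subtendMoment (A B : E3) : E3 := ∫ v : S2, (subtend A B v).arg • (v : E3) ∂area

lemma subtendMoment_map (R : E3 ≃ₗᵢ[ℝ] E3) {A B : E3} (hR : R (cross A B) = cross (R A) (R B)) :
    subtendMoment (R A) (R B) = R (subtendMoment A B) := by
  rw [subtendMoment, ← integral_sphereMap R, subtendMoment]
  have : ∀ v : E3, subtend (R A) (R B) (R v) = subtend A B v := by
    intro v
    simp only [subtend, LinearIsometryEquiv.inner_map_map, ← hR]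
  simp only [coe_sphereMap, this]
  rw [← LinearIsometryEquiv.coe_toContinuousLinearEquiv, ← ContinuousLinearEquiv.integral_comp_comm]
  simp

/-- Reflection in the plane of the arc fixes `A` and `B` and reverses the angle, so it negates the
moment; hence the moment is normal to that plane. -/
lemma subtendMoment_mem_span {A B : E3} (h : cross A B ≠ 0) :
    subtendMoment A B ∈ ℝ ∙ cross A B := by
  set K := ℝ ∙ cross A B
  set ρ := Kᗮ.reflection
  have hρn : ρ (cross A B) = -cross A B :=
    Submodule.reflection_mem_subspace_orthogonal_precomplement_eq_neg
      (Submodule.mem_span_singleton_self _)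
  have hρA : ρ A = A := Submodule.reflection_mem_subspace_eq_self
    (Submodule.mem_orthogonal_singleton_iff_inner_right.2 (inner_cross_left A B))
  have hρB : ρ B = B := Submodule.reflection_mem_subspace_eq_self
    (Submodule.mem_orthogonal_singleton_iff_inner_right.2 (inner_cross_right A B))
  have hinner : ∀ x y : E3, ⟪x, ρ y⟫ = ⟪ρ x, y⟫ := fun x y => by
    rw [← LinearIsometryEquiv.inner_map_map ρ, Submodule.reflection_reflection]
  have hneg : subtendMoment A B = -ρ (subtendMoment A B) := by
    have h1 : subtendMoment A B = ∫ v : S2, -((subtend A B v).arg • ρ v) ∂area := by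
      rw [subtendMoment, ← integral_sphereMap ρ]
      refine integral_congr_ae ?_
      filter_upwards [ae_inner_ne_zero h] with v hv
      have : subtend A B (ρ v) = (starRingEnd ℂ) (subtend A B v) := by
        apply Complex.ext
        · simp only [subtend, Complex.conj_re, hinner, hρA, hρB]
        · simp only [subtend, Complex.conj_im, hinner, hρn, inner_neg_left]
      simp only [coe_sphereMap, this, Complex.arg_conj]
      -- Conjugation negates the argument except where it equals `π`; this happens only on the great
      -- circle of the arc, a null set.
      rw [if_neg fun h0 => hv (Complex.arg_eq_pi_iff.1 h0).2, neg_smul]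
    rw [integral_neg] at h1
    rw [h1]
    congr 1
    rw [← h1, subtendMoment, ← LinearIsometryEquiv.coe_toContinuousLinearEquiv,
      ← ContinuousLinearEquiv.integral_comp_comm]
    simp
  rw [← Submodule.reflection_eq_self_iff]
  have := Submodule.reflection_orthogonal_apply (K := K) (subtendMoment A B)
  rw [← neg_eq_iff_eq_neg] at this
  rw [← this]
  exact hneg.symm

lemma arg_mul_im_pos {z : ℂ} (hz : z.im ≠ 0) : 0 < z.arg * z.im := by
  rcases lt_or_gt_of_ne hz with h | h
  · exact mul_pos_of_neg_of_neg (Complex.arg_neg_iff.2 h) h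
  · refine mul_pos (lt_of_le_of_ne (Complex.arg_nonneg_iff.2 h.le) fun h0 => ?_) h
    exact hz (Complex.arg_eq_zero_iff.1 h0.symm).2

/-- The angle is positive to the left of the arc and negative to the right, so the integrand is
positive almost everywhere. -/
lemma inner_subtendMoment_pos {A B : E3} (h : cross A B ≠ 0) :
    0 < ⟪cross A B, subtendMoment A B⟫ := by
  have hint := integrable_arg_subtend A B
  rw [subtendMoment, ← integral_inner hint]
  have hpos : ∀ᵐ v : S2 ∂area, 0 < ⟪cross A B, (subtend A B v).arg • (v : E3)⟫ := by
    filter_upwards [ae_inner_ne_zero h] with v hv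
    rw [inner_smul_right]
    exact arg_mul_im_pos hv
  rw [integral_pos_iff_support_of_nonneg_ae (hpos.mono fun _ h => h.le) (hint.const_inner _)]
  rw [pos_iff_ne_zero]
  intro h0
  have h1 : ∀ᵐ v : S2 ∂area, False := by
    filter_upwards [hpos, measure_eq_zero_iff_ae_notMem.1 h0] with v h1 h2
    exact h2 h1.ne'
  rw [Filter.eventually_false_iff_eq_bot, ae_eq_bot] at h1
  exact area_ne_zero h1

/-- Gram–Schmidt applied to `A`, `B`, completed by the unit normal. Arcs of equal length have equal
coordinates in their bases, so matching the bases carries one arc, together with its normal, to the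
other. -/
lemma exists_orthonormalBasis {A B : S2} {c : ℝ} (hc : ⟪(A : E3), (B : E3)⟫ = c)
    (h : c ^ 2 < 1) : ∃ b : OrthonormalBasis (Fin 3) ℝ E3, b 0 = A ∧
      c • b 0 + √(1 - c ^ 2) • b 1 = B ∧ √(1 - c ^ 2) • b 2 = cross A B := by
  set s := √(1 - c ^ 2) with hs
  have hs0 : s ≠ 0 := (Real.sqrt_pos.2 (by linarith)).ne'
  have hs2 : s ^ 2 = 1 - c ^ 2 := Real.sq_sqrt (by linarith)
  have hA := inner_self_sphere A
  have hB := inner_self_sphere B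
  have hBA : ⟪(B : E3), (A : E3)⟫ = c := by rw [real_inner_comm, hc]
  have hX := inner_cross_cross (A : E3) B
  have hXA := inner_cross_left (A : E3) B
  have hXB := inner_cross_right (A : E3) B
  have hAX : ⟪(A : E3), cross A B⟫ = 0 := by rw [real_inner_comm, hXA]
  have hBX : ⟪(B : E3), cross A B⟫ = 0 := by rw [real_inner_comm, hXB]
  rw [hA, hB, hc, one_mul, ← hs2] at hX
  have hon : Orthonormal ℝ ![(A : E3), s⁻¹ • ((B : E3) - c • (A : E3)), s⁻¹ • cross A B] := by
    rw [orthonormal_iff_ite]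
    intro i j
    fin_cases i <;> fin_cases j <;>
      simp [inner_smul_left, inner_smul_right, inner_sub_left, inner_sub_right,
        -inner_self_eq_norm_sq_to_K, hA, hB, hc, hBA, hX, hXA, hXB, hAX, hBX]
    · field_simp
      linarith
    · field_simp
  refine ⟨(basisOfOrthonormalOfCardEqFinrank hon (by simp)).toOrthonormalBasis (by simpa using hon),
    ?_, ?_, ?_⟩
  · simp
  · simp [smul_smul, hs0]
  · simp [smul_smul, hs0]

/-- The moment of the angle at which an arc is seen is a multiple of the normal of the arc, with a
positive factor that depends only on the length of the arc. -/
lemma exists_subtendMoment_eq (c : ℝ) (hc : c ^ 2 < 1) : ∃ κ : ℝ, 0 < κ ∧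
    ∀ A B : S2, ⟪(A : E3), (B : E3)⟫ = c → subtendMoment A B = κ • cross A B := by
  by_cases hex : ∃ A B : S2, ⟪(A : E3), (B : E3)⟫ = c
  · obtain ⟨A, B, hAB⟩ := hex
    have hX : cross (A : E3) B ≠ 0 := cross_ne_zero (by rwa [hAB])
    obtain ⟨κ, hκ⟩ := Submodule.mem_span_singleton.1 (subtendMoment_mem_span hX)
    refine ⟨κ, ?_, fun A' B' hAB' => ?_⟩
    · have h1 := inner_subtendMoment_pos hX
      rw [← hκ, inner_smul_right] at h1
      exact pos_of_mul_pos_left h1 real_inner_self_nonneg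
    · obtain ⟨b, h0, h1, h2⟩ := exists_orthonormalBasis hAB hc
      obtain ⟨b', h0', h1', h2'⟩ := exists_orthonormalBasis hAB' hc
      set R := b.equiv b' (Equiv.refl _)
      have hR : ∀ i, R (b i) = b' i := fun i => by simp [R]
      have hRA : R A = A' := by rw [← h0, hR, h0']
      have hRB : R B = B' := by rw [← h1, map_add, map_smul, map_smul, hR, hR, h1']
      have hRX : R (cross A B) = cross A' B' := by rw [← h2, map_smul, hR, h2']
      rw [← hRA, ← hRB, subtendMoment_map R (by rw [hRA, hRB, hRX]), ← hκ, map_smul, hRX, hRA, hRB]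
  · exact ⟨1, one_pos, fun A B h => (hex ⟨A, B, h⟩).elim⟩

/-! ### Points near a side -/

/-- A point of the great circle through `A` and `B` in terms of `A` and `B`. -/
lemma exists_eq_add {A B p : S2} (h : ⟪(A : E3), (B : E3)⟫ ^ 2 < 1)
    (hp : ⟪cross (A : E3) B, (p : E3)⟫ = 0) :
    ∃ s t : ℝ, (p : E3) = s • (A : E3) + t • (B : E3) := by
  obtain ⟨b, h0, h1, h2⟩ := exists_orthonormalBasis rfl h
  set c := ⟪(A : E3), (B : E3)⟫
  have hs : √(1 - c ^ 2) ≠ 0 := (Real.sqrt_pos.2 (by linarith)).ne'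
  have hb2 : ⟪b 2, (p : E3)⟫ = 0 := by
    rw [← h2, inner_smul_left] at hp
    exact (mul_eq_zero.1 hp).resolve_left hs
  have hb1 : b 1 = (√(1 - c ^ 2))⁻¹ • ((B : E3) - c • (A : E3)) := by
    rw [← h1, ← h0, add_sub_cancel_left, smul_smul, inv_mul_cancel₀ hs, one_smul]
  have hsum := b.sum_repr' (p : E3)
  rw [Fin.sum_univ_three, hb2, zero_smul, add_zero, h0] at hsum
  refine ⟨⟪(A : E3), (p : E3)⟫ - ⟪b 1, (p : E3)⟫ * (√(1 - c ^ 2))⁻¹ * c,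
    ⟪b 1, (p : E3)⟫ * (√(1 - c ^ 2))⁻¹, ?_⟩
  generalize ⟪b 1, (p : E3)⟫ = y at hsum ⊢
  generalize ⟪(A : E3), (p : E3)⟫ = x at hsum ⊢
  rw [← hsum, hb1]
  module

lemma mem_arc_iff {A B p : S2} (h : ⟪(A : E3), (B : E3)⟫ ^ 2 < 1) {s t : ℝ}
    (hp : (p : E3) = s • (A : E3) + t • (B : E3)) : p ∈ arc A B ↔ 0 ≤ s ∧ 0 ≤ t := by
  refine ⟨?_, fun h => ⟨s, t, h.1, h.2, hp⟩⟩
  rintro ⟨s', t', hs', ht', hp'⟩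
  have hA := inner_self_sphere A
  have hB := inner_self_sphere B
  have hBA := real_inner_comm (A : E3) (B : E3)
  have e := hp.symm.trans hp'
  have e1 := congrArg (fun x => ⟪(A : E3), x⟫) e
  have e2 := congrArg (fun x => ⟪(B : E3), x⟫) e
  simp only [inner_add_right, inner_smul_right, hA, hB, ← hBA] at e1 e2
  have h1 : (s - s') * (1 - ⟪(B : E3), (A : E3)⟫ ^ 2) = 0 := by
    linear_combination e1 - ⟪(B : E3), (A : E3)⟫ * e2
  have h2 : (t - t') * (1 - ⟪(B : E3), (A : E3)⟫ ^ 2) = 0 := by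
    linear_combination e2 - ⟪(B : E3), (A : E3)⟫ * e1
  rw [← hBA] at h
  have h0 : 1 - ⟪(B : E3), (A : E3)⟫ ^ 2 ≠ 0 := by linarith
  have h3 := (mul_eq_zero.1 h1).resolve_right h0
  have h4 := (mul_eq_zero.1 h2).resolve_right h0
  constructor <;> linarith

/-- The value is negative exactly when `s` and `t` have the same sign, that is, when `p` or `-p` is
in the interior of the arc. -/
lemma subtend_add {A B p : S2} {s t : ℝ} (hp : (p : E3) = s • (A : E3) + t • (B : E3)) :
    subtend A B p = ((-(s * t * (1 - ⟪(A : E3), (B : E3)⟫ ^ 2)) : ℝ) : ℂ) := by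
  have hA := inner_self_sphere A
  have hB := inner_self_sphere B
  have hBA := real_inner_comm (A : E3) (B : E3)
  have hpp := inner_self_sphere p
  apply Complex.ext
  · rw [hp] at hpp
    simp only [inner_add_left, inner_smul_left, inner_add_right, inner_smul_right, hA, hB, hBA,
      RCLike.conj_to_real] at hpp
    simp only [subtend, hp, Complex.ofReal_re, inner_add_right, inner_smul_right, hA, hB, hBA]
    linear_combination -⟪(A : E3), (B : E3)⟫ * hpp
  · simp only [subtend, hp, Complex.ofReal_im, inner_add_right, inner_smul_right,
      inner_cross_left, inner_cross_right, mul_zero, add_zero]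

lemma eq_or_eq_neg_of_eq_smul {p B : S2} {t : ℝ} (h : (p : E3) = t • (B : E3)) :
    p = B ∨ p = -B := by
  have h1 := congrArg norm h
  rw [norm_smul, norm_eq_of_mem_sphere, norm_eq_of_mem_sphere, mul_one, Real.norm_eq_abs, eq_comm,
    abs_eq zero_le_one] at h1
  rcases h1 with rfl | rfl
  · exact Or.inl (Subtype.ext (by rw [h, one_smul]))
  · exact Or.inr (Subtype.ext (by rw [h, neg_one_smul, coe_neg_sphere]))

open scoped Classical in
/-- Corrected by half-turns where `p` or its antipode is on the arc, the angle at which the arc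
is seen is continuous at `p`. -/
lemma exists_tendsto_arg_subtend {A B p : S2} (h : ⟪(A : E3), (B : E3)⟫ ^ 2 < 1)
    (h1 : p ≠ A) (h2 : p ≠ -A) (h3 : p ≠ B) (h4 : p ≠ -B) :
    ∃ c : ℝ, Tendsto (fun q : S2 => (subtend A B q).arg -
      Real.pi * ((if p ∈ arc A B then ((SignType.sign ⟪cross (A : E3) B, (q : E3)⟫ : ℤ) : ℝ) else 0)
        - (if -p ∈ arc A B then
          ((SignType.sign ⟪cross (A : E3) B, ((-q : S2) : E3)⟫ : ℤ) : ℝ) else 0)))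
      (𝓝[{q : S2 | ⟪cross (A : E3) B, (q : E3)⟫ ≠ 0}] p) (𝓝 c) := by
  have hcont : Tendsto (fun q : S2 => subtend A B q) (𝓝 p) (𝓝 (subtend A B p)) :=
    ((continuous_subtend A B).comp continuous_subtype_val).tendsto p
  have harc : ∀ {x : S2}, x ∈ arc A B → ⟪cross (A : E3) B, (x : E3)⟫ = 0 := by
    rintro x ⟨s, t, -, -, hx⟩
    rw [hx, inner_add_right, inner_smul_right, inner_smul_right, inner_cross_left,
      inner_cross_right, mul_zero, mul_zero, add_zero]
  have hslit : p ∉ arc A B → -p ∉ arc A B → subtend A B p ∈ Complex.slitPlane → ∃ c : ℝ,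
      Tendsto (fun q : S2 => (subtend A B q).arg -
      Real.pi * ((if p ∈ arc A B then ((SignType.sign ⟪cross (A : E3) B, (q : E3)⟫ : ℤ) : ℝ) else 0)
        - (if -p ∈ arc A B then
          ((SignType.sign ⟪cross (A : E3) B, ((-q : S2) : E3)⟫ : ℤ) : ℝ) else 0)))
      (𝓝[{q : S2 | ⟪cross (A : E3) B, (q : E3)⟫ ≠ 0}] p) (𝓝 c) := by
    intro ha hb hz
    simp only [if_neg ha, if_neg hb, sub_self, mul_zero, sub_zero]
    exact ⟨_, ((Complex.continuousAt_arg hz).tendsto.comp hcont).mono_left nhdsWithin_le_nhds⟩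
  by_cases hp : ⟪cross (A : E3) B, (p : E3)⟫ = 0
  · obtain ⟨s, t, hst⟩ := exists_eq_add h hp
    have hst' : ((-p : S2) : E3) = (-s) • (A : E3) + (-t) • (B : E3) := by
      rw [coe_neg_sphere, hst]
      module
    have hs : s ≠ 0 := by
      rintro rfl
      rw [zero_smul, zero_add] at hst
      exact (eq_or_eq_neg_of_eq_smul hst).elim h3 h4
    have ht : t ≠ 0 := by
      rintro rfl
      rw [zero_smul, add_zero] at hst
      exact (eq_or_eq_neg_of_eq_smul hst).elim h1 h2
    have hz := subtend_add hst
    have hm := mem_arc_iff h hst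
    have hm' := mem_arc_iff h hst'
    rw [neg_nonneg, neg_nonneg] at hm'
    rcases lt_or_gt_of_ne (mul_ne_zero hs ht) with hlt | hgt
    · refine hslit ?_ ?_ ?_
      · rw [hm]
        rintro ⟨h5, h6⟩
        exact hlt.not_ge (mul_nonneg h5 h6)
      · rw [hm']
        rintro ⟨h5, h6⟩
        exact hlt.not_ge (mul_nonneg_of_nonpos_of_nonpos h5 h6)
      · rw [hz, Complex.ofReal_mem_slitPlane]
        nlinarith
    -- Here `subtend` is on the branch cut, so the argument of its negative is used; it differs by a
    -- half-turn whose sign depends on the side of the great circle.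
    · have hz' : -subtend A B p ∈ Complex.slitPlane := by
        rw [hz, ← Complex.ofReal_neg, Complex.ofReal_mem_slitPlane, neg_neg]
        exact mul_pos hgt (by linarith)
      refine ⟨(-subtend A B p).arg, Tendsto.congr' ?_ (((Complex.continuousAt_arg hz').tendsto.comp
        hcont.neg).mono_left nhdsWithin_le_nhds)⟩
      filter_upwards [self_mem_nhdsWithin] with q hq
      have hcorr : ((if p ∈ arc A B then
          ((SignType.sign ⟪cross (A : E3) B, (q : E3)⟫ : ℤ) : ℝ) else 0)
          - (if -p ∈ arc A B then
          ((SignType.sign ⟪cross (A : E3) B, ((-q : S2) : E3)⟫ : ℤ) : ℝ) else 0)) =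
          ((SignType.sign ⟪cross (A : E3) B, (q : E3)⟫ : ℤ) : ℝ) := by
        rcases lt_or_gt_of_ne hs with h5 | h5
        · have h6 : t < 0 := by
            by_contra! h6
            exact hgt.not_ge (mul_nonpos_of_nonpos_of_nonneg h5.le h6)
          rw [if_neg fun h7 => h5.not_ge (hm.1 h7).1, if_pos (hm'.2 ⟨h5.le, h6.le⟩),
            coe_neg_sphere, inner_neg_right, Left.sign_neg]
          simp
        · have h6 : 0 < t := pos_of_mul_pos_right hgt h5.le
          rw [if_pos (hm.2 ⟨h5.le, h6.le⟩), if_neg fun h7 => h5.not_ge (hm'.1 h7).1, sub_zero]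
      rw [hcorr, Function.comp_apply]
      rcases lt_or_gt_of_ne (show ⟪cross (A : E3) B, (q : E3)⟫ ≠ 0 from hq) with h5 | h5
      · rw [Complex.arg_neg_eq_arg_add_pi_of_im_neg (by exact h5), sign_neg h5]
        simp
      · rw [Complex.arg_neg_eq_arg_sub_pi_of_im_pos (by exact h5), sign_pos h5]
        simp
  · refine hslit (fun h5 => hp (harc h5)) (fun h5 => ?_) (Or.inr hp)
    have := harc h5
    rw [coe_neg_sphere, inner_neg_right, neg_eq_zero] at this
    exact hp this

/-- Arbitrarily close to a point of a great circle there are points on a given side of it. -/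
lemma exists_inner_pos {n : E3} (hn : n ≠ 0) {p : S2} (hp : ⟪n, (p : E3)⟫ = 0) {N : Set S2}
    (hN : N ∈ 𝓝 p) : ∃ q ∈ N, 0 < ⟪n, (q : E3)⟫ := by
  obtain ⟨U, hU, hUN⟩ := mem_nhds_induced _ _ _ |>.1 hN
  have hpn : ⟪(p : E3), n⟫ = 0 := by rw [real_inner_comm, hp]
  have h0 : ∀ t : ℝ, (p : E3) + t • n ≠ 0 := by
    intro t h
    have := congrArg (fun x => ⟪(p : E3), x⟫) h
    simp only [inner_add_right, inner_smul_right, inner_self_sphere, hpn, inner_zero_right] at this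
    norm_num at this
  have hc : Tendsto (fun t : ℝ => ‖(p : E3) + t • n‖⁻¹ • ((p : E3) + t • n)) (𝓝 0) (𝓝 p) := by
    have : Continuous fun t : ℝ => ‖(p : E3) + t • n‖⁻¹ • ((p : E3) + t • n) :=
      (Continuous.inv₀ (by fun_prop) fun t => norm_ne_zero_iff.2 (h0 t)).smul (by fun_prop)
    simpa using this.tendsto 0
  obtain ⟨t, htU, ht⟩ := (((hc.eventually hU).filter_mono nhdsWithin_le_nhds).and
    (self_mem_nhdsWithin (s := Ioi (0 : ℝ)))).exists
  have h1 := norm_pos_iff.2 (h0 t)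
  refine ⟨⟨‖(p : E3) + t • n‖⁻¹ • ((p : E3) + t • n), ?_⟩, hUN htU, ?_⟩
  · rw [mem_sphere_zero_iff_norm, norm_smul, norm_inv, norm_norm, inv_mul_cancel₀ h1.ne']
  · rw [inner_smul_right, inner_add_right, hp, zero_add, inner_smul_right]
    exact mul_pos (inv_pos.2 h1) (mul_pos ht (real_inner_self_pos.2 hn))

/-! ### Multiplicity and winding number near a point that is not exceptional. -/

section Polygon

variable {n : ℕ} [NeZero n]

lemma IsPolygon.inner_sq_lt_one {V : Fin n → S2} (hV : IsPolygon V) (i : Fin n) :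
    ⟪(V i : E3), (V (i + 1) : E3)⟫ ^ 2 < 1 :=
  SphericalPolygon.inner_sq_lt_one (hV i).1 (hV i).2

lemma IsPolygon.leftNormal_ne_zero {V : Fin n → S2} (hV : IsPolygon V) (i : Fin n) :
    leftNormal V i ≠ 0 := cross_ne_zero (hV.inner_sq_lt_one i)

lemma inner_leftNormal_of_mem_side {V : Fin n → S2} {i : Fin n} {p : S2} (h : p ∈ side V i) :
    ⟪leftNormal V i, (p : E3)⟫ = 0 := by
  obtain ⟨s, t, -, -, hx⟩ := h
  rw [hx, leftNormal, inner_add_right, inner_smul_right, inner_smul_right, inner_cross_left,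
    inner_cross_right, mul_zero, mul_zero, add_zero]

/-- The points that are on none of the great circles of the sides. -/
def offCircles (V : Fin n → S2) : Set S2 := {v | ∀ i, ⟪leftNormal V i, (v : E3)⟫ ≠ 0}

/-- The vertices, their antipodes, and the intersections of different great circles of sides. -/
def exceptional (V : Fin n → S2) : Set S2 :=
  {p | (∃ i, p = V i ∨ p = -V i) ∨ ∃ i j, cross (leftNormal V i) (leftNormal V j) ≠ 0 ∧
    ⟪leftNormal V i, (p : E3)⟫ = 0 ∧ ⟪leftNormal V j, (p : E3)⟫ = 0}

lemma neg_notMem_exceptional {V : Fin n → S2} {p : S2} (h : p ∉ exceptional V) :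
    -p ∉ exceptional V := by
  contrapose! h
  rcases h with ⟨i, h | h⟩ | ⟨i, j, h1, h2, h3⟩
  · exact Or.inl ⟨i, Or.inr (neg_eq_iff_eq_neg.1 h)⟩
  · exact Or.inl ⟨i, Or.inl (neg_inj.1 h)⟩
  · rw [coe_neg_sphere, inner_neg_right, neg_eq_zero] at h2 h3
    exact Or.inr ⟨i, j, h1, h2, h3⟩

lemma neg_mem_offCircles {V : Fin n → S2} {p : S2} (h : p ∈ offCircles V) :
    -p ∈ offCircles V := by
  intro i
  rw [coe_neg_sphere, inner_neg_right]
  exact neg_ne_zero.2 (h i)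

open scoped Classical in
/-- The sum of the signs of the position of `q` with respect to the sides through `p`. -/
def sideSum (V : Fin n → S2) (p q : S2) : ℝ :=
  ∑ j, if p ∈ side V j then ((SignType.sign ⟪leftNormal V j, (q : E3)⟫ : ℤ) : ℝ) else 0

lemma inner_self_mul_of_cross_eq_zero {a b : E3} (h : cross a b = 0) (x : E3) :
    ⟪a, a⟫ * ⟪b, x⟫ = ⟪a, b⟫ * ⟪a, x⟫ := by
  have h0 := congrArg (fun y : E3 => y 0) h
  have h1 := congrArg (fun y : E3 => y 1) h
  have h2 := congrArg (fun y : E3 => y 2) h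
  simp only [cross_zero, cross_one, cross_two, PiLp.zero_apply] at h0 h1 h2
  simp only [inner_eq]
  linear_combination (a 1 * x 2 - a 2 * x 1) * h0 + (a 2 * x 0 - a 0 * x 2) * h1 +
    (a 0 * x 1 - a 1 * x 0) * h2

/-- All sides through such a point lie in one great circle, so their normals are parallel and the
signs at `q` differ only by the relative directions. -/
lemma sideSum_eq {V : Fin n → S2} (hV : IsPolygon V) {p : S2} (hp : p ∉ exceptional V) {i : Fin n}
    (hi : p ∈ side V i) (q : S2) : sideSum V p q =
      netMultiplicity V i p * ((SignType.sign ⟪leftNormal V i, (q : E3)⟫ : ℤ) : ℝ) := by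
  rw [sideSum, netMultiplicity, Int.cast_sum, Finset.sum_mul]
  refine Finset.sum_congr rfl fun j _ => ?_
  split_ifs with hj
  · have hc : cross (leftNormal V i) (leftNormal V j) = 0 := by
      by_contra hc
      exact hp (Or.inr ⟨i, j, hc, inner_leftNormal_of_mem_side hi, inner_leftNormal_of_mem_side hj⟩)
    have h1 := congrArg SignType.sign (inner_self_mul_of_cross_eq_zero hc (q : E3))
    rw [sign_mul, sign_mul, sign_pos (real_inner_self_pos.2 (hV.leftNormal_ne_zero i)),
      one_mul] at h1
    rw [h1]
    push_cast
    simp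
  · simp

/-- The multiplicity function of a lamina near a point that is not exceptional. -/
lemma IsLaminaBoundedBy.exists_eventually_eq {V : Fin n → S2} (hV : IsPolygon V) {m : S2 → ℤ}
    (hm : IsLaminaBoundedBy V m) {p : S2} (hp : p ∉ exceptional V) :
    ∃ c : ℝ, ∀ᶠ q in 𝓝 p, q ∈ offCircles V → (m q : ℝ) = c + 1 / 2 * sideSum V p q := by
  by_cases htr : p ∈ trace V
  · obtain ⟨i, hi⟩ := mem_iUnion.1 htr
    have hpi := inner_leftNormal_of_mem_side hi
    have hjump := hm.jump i p hi (fun j hj => hp (Or.inl ⟨j, Or.inl hj⟩)) fun j hj => by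
      by_contra hc
      exact hp (Or.inr ⟨i, j, hc, hpi, inner_leftNormal_of_mem_side hj⟩)
    rw [nhds_prod_eq, eventually_prod_self_iff'] at hjump
    obtain ⟨N, hN, hjump⟩ := hjump
    obtain ⟨q₁, hq₁, hpos⟩ := exists_inner_pos (hV.leftNormal_ne_zero i) hpi hN
    obtain ⟨q₂, hq₂, hneg⟩ := exists_inner_pos (neg_ne_zero.2 (hV.leftNormal_ne_zero i))
      (by rw [inner_neg_left, hpi, neg_zero]) hN
    rw [inner_neg_left, neg_pos] at hneg
    -- The mean of the values of `m` on the two sides of the curve.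
    refine ⟨m q₂ + 1 / 2 * netMultiplicity V i p, ?_⟩
    filter_upwards [hN] with q hq hqD
    rw [sideSum_eq hV hp hi]
    rcases lt_or_gt_of_ne (hqD i) with h | h
    · have e1 := hjump q₁ hq₁ q hq hpos h
      have e2 := hjump q₁ hq₁ q₂ hq₂ hpos hneg
      rw [sign_neg h, show m q = m q₂ by simp only at e1 e2; linarith]
      simp
    · have e1 := hjump q hq q₂ hq₂ h hneg
      rw [sign_pos h, show m q = m q₂ + netMultiplicity V i p by simp only at e1; linarith]
      push_cast
      simp
      ring
  · refine ⟨m p, ?_⟩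
    have h0 : ∀ q, sideSum V p q = 0 := fun q => Finset.sum_eq_zero fun j _ =>
      if_neg fun hj => htr (mem_iUnion.2 ⟨j, hj⟩)
    filter_upwards [hm.locallyConst p htr] with q hq _
    rw [hq, h0, mul_zero, add_zero]

/-- The difference between the antisymmetrized multiplicity and the winding number. -/
def defect (V : Fin n → S2) (m : S2 → ℤ) (q : S2) : ℝ :=
  m q - m (-q) - (2 * Real.pi)⁻¹ * ∑ i, (subtend (V i) (V (i + 1)) q).arg

lemma exists_tendsto_defect {V : Fin n → S2} (hV : IsPolygon V) {m : S2 → ℤ}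
    (hm : IsLaminaBoundedBy V m) {p : S2} (hp : p ∉ exceptional V) :
    ∃ c : ℝ, Tendsto (defect V m) (𝓝[offCircles V] p) (𝓝 c) := by
  classical
  obtain ⟨c₁, h₁⟩ := hm.exists_eventually_eq hV hp
  obtain ⟨c₂, h₂⟩ := hm.exists_eventually_eq hV (neg_notMem_exceptional hp)
  have hex := fun i => exists_tendsto_arg_subtend (p := p) (hV.inner_sq_lt_one i)
    (fun h => hp (Or.inl ⟨i, Or.inl h⟩)) (fun h => hp (Or.inl ⟨i, Or.inr h⟩))
    (fun h => hp (Or.inl ⟨i + 1, Or.inl h⟩)) (fun h => hp (Or.inl ⟨i + 1, Or.inr h⟩))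
  choose c hc using hex
  have hsum := tendsto_finsetSum Finset.univ fun i _ =>
    (hc i).mono_left (nhdsWithin_mono p fun q (hq : q ∈ offCircles V) => hq i)
  refine ⟨_, ((tendsto_const_nhds (x := c₁ - c₂)).sub
    (hsum.const_mul (2 * Real.pi)⁻¹)).congr' ?_⟩
  have h₂' : ∀ᶠ q in 𝓝 p, -q ∈ offCircles V →
      (m (-q) : ℝ) = c₂ + 1 / 2 * sideSum V (-p) (-q) :=
    (continuous_neg.tendsto p).eventually h₂
  filter_upwards [self_mem_nhdsWithin, nhdsWithin_le_nhds h₁, nhdsWithin_le_nhds h₂']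
    with q hq e₁ e₂
  -- The half-jumps of `m` cancel the half-turn corrections, since `(2π)⁻¹ * π = 1/2`.
  rw [defect, e₁ hq, e₂ (neg_mem_offCircles hq), Finset.sum_sub_distrib, ← Finset.mul_sum,
    Finset.sum_sub_distrib]
  change _ - _ * (_ - Real.pi * (sideSum V p q - sideSum V (-p) (-q))) = _
  have := Real.pi_ne_zero
  field_simp
  ring

end Polygon

/-! ### Uniqueness of the multiplicity function -/

/-- Stereographic projection from `p` turns the set into the complement of a finite set in a plane.
-/
lemma isPreconnected_compl_of_finite {F : Set S2} (hF : F.Finite) {p : S2} (hp : p ∈ F) :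
    IsPreconnected Fᶜ := by
  have hn : ‖(p : E3)‖ = 1 := norm_eq_of_mem_sphere p
  set e := stereographic hn
  have hsrc : e.source = {p}ᶜ := stereographic_source hn
  have htgt : e.target = univ := stereographic_target hn
  have hrank : 1 < Module.rank ℝ (ℝ ∙ (p : E3))ᗮ := by
    have : Fact (Module.finrank ℝ E3 = 2 + 1) := ⟨by simp⟩
    have h2 := Submodule.finrank_orthogonal_span_singleton (𝕜 := ℝ) (n := 2)
      (ne_zero_of_mem_unit_sphere p)
    rw [← Module.finrank_eq_rank, h2]
    norm_num
  have hconn := (((hF.sdiff (t := {p})).image e).countable.isConnected_compl_of_one_lt_rank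
    hrank).isPreconnected
  have himg : Fᶜ = e.symm '' (e '' (F \ {p}))ᶜ := by
    ext q
    constructor
    · intro hq
      have hqs : q ∈ e.source := by
        rw [hsrc]
        rintro rfl
        exact hq hp
      refine ⟨e q, ?_, e.left_inv hqs⟩
      rintro ⟨r, ⟨hr, hrp⟩, hrq⟩
      exact hq (e.injOn (by rwa [hsrc]) hqs hrq ▸ hr)
    · rintro ⟨y, hy, rfl⟩ hyF
      have hyt : y ∈ e.target := htgt ▸ mem_univ y
      have hys := e.map_target hyt
      rw [hsrc] at hys
      exact hy ⟨e.symm y, ⟨hyF, hys⟩, e.right_inv hyt⟩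
  rw [himg]
  exact hconn.image _ (e.continuousOn_symm.mono (by rw [htgt]; exact subset_univ _))

lemma inner_self_smul_of_cross_eq_zero {w x : E3} (h : cross w x = 0) :
    ⟪x, x⟫ • w = ⟪w, x⟫ • x := by
  have h0 := congrArg (fun y : E3 => y 0) h
  have h1 := congrArg (fun y : E3 => y 1) h
  have h2 := congrArg (fun y : E3 => y 2) h
  simp only [cross_zero, cross_one, cross_two, PiLp.zero_apply] at h0 h1 h2
  apply ext_coord <;> simp only [PiLp.smul_apply, smul_eq_mul, inner_eq]
  · linear_combination x 1 * h2 - x 2 * h1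
  · linear_combination x 2 * h0 - x 0 * h2
  · linear_combination x 0 * h1 - x 1 * h0

lemma cross_cross_eq_zero {a b x : E3} (ha : ⟪a, x⟫ = 0) (hb : ⟪b, x⟫ = 0) :
    cross (cross a b) x = 0 := by
  simp only [inner_eq] at ha hb
  apply ext_coord <;> simp only [PiLp.zero_apply, cross_zero, cross_one, cross_two]
  · linear_combination b 0 * ha - a 0 * hb
  · linear_combination b 1 * ha - a 1 * hb
  · linear_combination b 2 * ha - a 2 * hb

/-- Two different great circles meet in two antipodal points. -/
lemma finite_inter_circles {a b : E3} (h : cross a b ≠ 0) :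
    {p : S2 | ⟪a, (p : E3)⟫ = 0 ∧ ⟪b, (p : E3)⟫ = 0}.Finite := by
  set S := {p : S2 | ⟪a, (p : E3)⟫ = 0 ∧ ⟪b, (p : E3)⟫ = 0}
  have hS : ∀ p ∈ S, cross a b = ⟪cross a b, (p : E3)⟫ • (p : E3) := by
    intro p hp
    have := inner_self_smul_of_cross_eq_zero (cross_cross_eq_zero hp.1 hp.2)
    rwa [inner_self_sphere, one_smul] at this
  rcases S.eq_empty_or_nonempty with h0 | ⟨p₀, hp₀⟩
  · rw [h0]
    exact finite_empty
  · refine (toFinite {p₀, -p₀}).subset fun p hp => ?_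
    have e := hS p hp
    have hne : ⟪cross a b, (p : E3)⟫ ≠ 0 := by
      intro h1
      rw [h1, zero_smul] at e
      exact h e
    refine eq_or_eq_neg_of_eq_smul (t := ⟪cross a b, (p : E3)⟫⁻¹ * ⟪cross a b, (p₀ : E3)⟫) ?_
    rw [mul_smul, ← hS p₀ hp₀]
    exact (inv_smul_eq_iff₀ hne).2 e |>.symm

section Polygon

variable {n : ℕ} [NeZero n]

lemma finite_exceptional (V : Fin n → S2) : (exceptional V).Finite := by
  have : exceptional V ⊆ (⋃ i, {V i, -V i}) ∪ ⋃ i, ⋃ j,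
      {p : S2 | cross (leftNormal V i) (leftNormal V j) ≠ 0 ∧
        ⟪leftNormal V i, (p : E3)⟫ = 0 ∧ ⟪leftNormal V j, (p : E3)⟫ = 0} := by
    rintro p (⟨i, hi⟩ | ⟨i, j, hij⟩)
    · exact Or.inl (mem_iUnion.2 ⟨i, hi⟩)
    · exact Or.inr (mem_iUnion.2 ⟨i, mem_iUnion.2 ⟨j, hij⟩⟩)
  refine Finite.subset (Finite.union (finite_iUnion fun i => toFinite _)
    (finite_iUnion fun i => finite_iUnion fun j => ?_)) this
  by_cases h : cross (leftNormal V i) (leftNormal V j) = 0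
  · simp [h]
  · exact (finite_inter_circles h).subset fun p hp => hp.2

lemma ae_mem_offCircles {V : Fin n → S2} (hV : IsPolygon V) :
    ∀ᵐ v ∂area, v ∈ offCircles V :=
  ae_all_iff.2 fun i => ae_inner_ne_zero (hV.leftNormal_ne_zero i)

lemma dense_offCircles {V : Fin n → S2} (hV : IsPolygon V) : Dense (offCircles V) := by
  have : area.IsOpenPosMeasure := by unfold area; infer_instance
  exact Measure.dense_of_ae (ae_mem_offCircles hV)

lemma isOpen_offCircles (V : Fin n → S2) : IsOpen (offCircles V) := by
  simp only [offCircles, ofPred_forall]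
  exact isOpen_iInter_of_finite fun i => isOpen_ne_fun (by fun_prop) continuous_const

lemma exists_defect_eq_intCast (V : Fin n → S2) (m : S2 → ℤ) {q : S2} (hq : q ∈ offCircles V) :
    ∃ k : ℤ, defect V m q = k := by
  obtain ⟨k, hk⟩ := sum_arg_subtend V q hq
  refine ⟨m q - m (-q) - k, ?_⟩
  rw [defect, hk]
  push_cast
  have := Real.pi_ne_zero
  field_simp

lemma exists_eventually_defect {V : Fin n → S2} (hV : IsPolygon V) {m : S2 → ℤ}
    (hm : IsLaminaBoundedBy V m) {p : S2} (hp : p ∉ exceptional V) :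
    ∃ k : ℤ, ∀ᶠ q in 𝓝 p, q ∈ offCircles V → defect V m q = k := by
  obtain ⟨c, hc⟩ := exists_tendsto_defect hV hm hp
  have hne : (𝓝[offCircles V] p).NeBot := mem_closure_iff_nhdsWithin_neBot.1 (dense_offCircles hV p)
  have hnear := (hc.eventually (Metric.ball_mem_nhds c (by norm_num : (0 : ℝ) < 1 / 2))).and
    self_mem_nhdsWithin
  obtain ⟨q₀, hq₀, hq₀D⟩ := hnear.exists
  obtain ⟨k, hk⟩ := exists_defect_eq_intCast V m hq₀D
  refine ⟨k, ?_⟩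
  filter_upwards [eventually_nhdsWithin_iff.1 (hc.eventually (Metric.ball_mem_nhds c
    (by norm_num : (0 : ℝ) < 1 / 2)))] with q hq hqD
  -- Both values are integers within `1/2` of the limit, hence equal.
  obtain ⟨l, hl⟩ := exists_defect_eq_intCast V m hqD
  have h1 := dist_triangle_right (defect V m q) (defect V m q₀) c
  have h2 : dist (defect V m q) (defect V m q₀) < 1 := by
    have h3 : dist (defect V m q) c < 1 / 2 := hq hqD
    have h4 : dist (defect V m q₀) c < 1 / 2 := hq₀
    linarith
  rw [hl, hk, Int.dist_cast_real, Int.dist_eq'] at h2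
  have h3 : |l - k| < 1 := by exact_mod_cast h2
  rw [hl, sub_eq_zero.1 (Int.abs_lt_one_iff.1 h3)]

/-- Up to a constant, the antisymmetrized multiplicity function is the winding number. -/
lemma exists_defect_eq {V : Fin n → S2} (hV : IsPolygon V) {m : S2 → ℤ}
    (hm : IsLaminaBoundedBy V m) : ∃ k : ℤ, ∀ q ∈ offCircles V, defect V m q = k := by
  have hex : ∀ p : S2, ∃ k : ℤ, p ∉ exceptional V →
      ∀ᶠ q in 𝓝 p, q ∈ offCircles V → defect V m q = k := by
    intro p
    by_cases hp : p ∈ exceptional V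
    · exact ⟨0, fun h => (h hp).elim⟩
    · obtain ⟨k, hk⟩ := exists_eventually_defect hV hm hp
      exact ⟨k, fun _ => hk⟩
  choose k hk using hex
  have hopen : IsOpen (exceptional V)ᶜ := (finite_exceptional V).isClosed.isOpen_compl
  have hcont : ContinuousOn k (exceptional V)ᶜ := by
    intro p hp
    refine ContinuousAt.continuousWithinAt
      (ContinuousAt.congr (f := fun _ => k p) continuousAt_const ?_)
    filter_upwards [(hk p hp).eventually_nhds, hopen.mem_nhds hp] with p' h₁ h₂
    -- By density, some point off the circles lies in both neighborhoods, so the local constants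
    -- agree.
    obtain ⟨q, hqD, hq⟩ := (dense_offCircles hV).inter_nhds_nonempty (h₁.and (hk p' h₂))
    exact_mod_cast (hq.1 hqD).symm.trans (hq.2 hqD)
  have hconn := isPreconnected_compl_of_finite (finite_exceptional V)
    (show V 0 ∈ exceptional V from Or.inl ⟨0, Or.inl rfl⟩)
  have hD : ∀ q ∈ offCircles V, q ∉ exceptional V ∧ defect V m q = k q := by
    intro q hq
    have : q ∉ exceptional V := by
      rintro (⟨i, h | h⟩ | ⟨i, j, -, h, -⟩)
      · exact hq i (h ▸ inner_cross_left _ _)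
      · refine hq i (h ▸ ?_)
        rw [coe_neg_sphere, inner_neg_right, neg_eq_zero]
        exact inner_cross_left _ _
      · exact hq i h
    exact ⟨this, (hk q this).self_of_nhds hq⟩
  obtain ⟨q₀, hq₀⟩ := @Dense.nonempty _ _ _ ⟨V 0⟩ (dense_offCircles hV)
  refine ⟨k q₀, fun q hq => ?_⟩
  rw [(hD q hq).2, hconn.constant hcont (hD q hq).1 (hD q₀ hq₀).1]

/-! ### Boundedness and integrability of the multiplicity function. -/

lemma notMem_trace_of_mem_offCircles {V : Fin n → S2} {q : S2} (hq : q ∈ offCircles V) :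
    q ∉ trace V := by
  intro h
  obtain ⟨i, hi⟩ := mem_iUnion.1 h
  exact hq i (inner_leftNormal_of_mem_side hi)

lemma IsLaminaBoundedBy.continuousAt {V : Fin n → S2} {m : S2 → ℤ} (hm : IsLaminaBoundedBy V m)
    {q : S2} (hq : q ∉ trace V) : ContinuousAt m q :=
  ContinuousAt.congr (f := fun _ => m q) continuousAt_const
    ((hm.locallyConst q hq).mono fun _ h => h.symm)

/-- The multiplicity function is constant where the signs with respect to the great circles of the
sides do not change. -/
lemma IsLaminaBoundedBy.eq_of_sign_eq {V : Fin n → S2} {m : S2 → ℤ} (hm : IsLaminaBoundedBy V m)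
    {q q' : S2} (hq : q ∈ offCircles V) (h : ∀ i, SignType.sign ⟪leftNormal V i, (q : E3)⟫ =
      SignType.sign ⟪leftNormal V i, (q' : E3)⟫) : m q = m q' := by
  -- The segment stays in the same open half-spaces, so it misses the origin and projects radially
  -- to a path off the circles.
  have hne : ∀ x : segment ℝ (q : E3) q', ∀ i, ⟪leftNormal V i, (x : E3)⟫ ≠ 0 := by
    rintro ⟨x, s, t, hs, ht, hst, rfl⟩ i
    have h1 := h i
    simp only [inner_add_right, inner_smul_right]
    rcases lt_or_gt_of_ne (hq i) with h2 | h2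
    · rw [sign_neg h2, eq_comm, sign_eq_neg_one_iff] at h1
      exact ((convex_Iio (0 : ℝ)) h2 h1 hs ht hst).ne
    · rw [sign_pos h2, eq_comm, sign_eq_one_iff] at h1
      exact ((convex_Ioi (0 : ℝ)) h2 h1 hs ht hst).ne'
  have hne0 : ∀ x : segment ℝ (q : E3) q', ‖(x : E3)‖ ≠ 0 := by
    intro x hx
    apply hne x 0
    rw [norm_eq_zero.1 hx, inner_zero_right]
  let φ : segment ℝ (q : E3) q' → S2 := fun x => ⟨‖(x : E3)‖⁻¹ • (x : E3), by
    rw [mem_sphere_zero_iff_norm, norm_smul, norm_inv, norm_norm, inv_mul_cancel₀ (hne0 x)]⟩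
  have hφ : Continuous φ := Continuous.subtype_mk
    ((Continuous.inv₀ (by fun_prop) hne0).smul continuous_subtype_val) _
  have hφD : ∀ x, φ x ∈ offCircles V := by
    intro x i
    simp only [φ, inner_smul_right]
    exact mul_ne_zero (inv_ne_zero (hne0 x)) (hne x i)
  have hcont : Continuous (m ∘ φ) := continuous_iff_continuousAt.2 fun x =>
    (hm.continuousAt (notMem_trace_of_mem_offCircles (hφD x))).comp hφ.continuousAt
  have hconn : PreconnectedSpace (segment ℝ (q : E3) q') :=
    Subtype.preconnectedSpace (convex_segment _ _).isPreconnected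
  have hq1 : φ ⟨q, left_mem_segment ℝ _ _⟩ = q := Subtype.ext (by simp [φ])
  have hq2 : φ ⟨q', right_mem_segment ℝ _ _⟩ = q' := Subtype.ext (by simp [φ])
  exact (congrArg m hq1).symm.trans ((hconn.constant hcont).trans (congrArg m hq2))

/-- Only finitely many sign patterns occur, and `m` is constant on each. -/
lemma IsLaminaBoundedBy.exists_bound {V : Fin n → S2} {m : S2 → ℤ} (hm : IsLaminaBoundedBy V m) :
    ∃ C : ℝ, ∀ q ∈ offCircles V, |(m q : ℝ)| ≤ C := by
  have hex : ∀ σ : Fin n → SignType, ∃ C : ℝ, ∀ q ∈ offCircles V,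
      (∀ i, SignType.sign ⟪leftNormal V i, (q : E3)⟫ = σ i) → |(m q : ℝ)| ≤ C := by
    intro σ
    by_cases h : ∃ q ∈ offCircles V, ∀ i, SignType.sign ⟪leftNormal V i, (q : E3)⟫ = σ i
    · obtain ⟨q₀, hq₀, hσ⟩ := h
      refine ⟨|(m q₀ : ℝ)|, fun q hq hqσ => ?_⟩
      rw [hm.eq_of_sign_eq hq fun i => (hqσ i).trans (hσ i).symm]
    · exact ⟨0, fun q hq hqσ => (h ⟨q, hq, hqσ⟩).elim⟩
  choose C hC using hex
  obtain ⟨M, hM⟩ := (finite_range C).bddAbove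
  exact ⟨M, fun q hq => (hC _ q hq fun i => rfl).trans (hM ⟨_, rfl⟩)⟩

lemma IsLaminaBoundedBy.integrable {V : Fin n → S2} (hV : IsPolygon V) {m : S2 → ℤ}
    (hm : IsLaminaBoundedBy V m) : Integrable (fun v : S2 => (m v : ℝ) • (v : E3)) area := by
  obtain ⟨C, hC⟩ := hm.exists_bound
  refine integrable_smul_coe ?_ C ((ae_mem_offCircles hV).mono hC)
  have hcont : ContinuousOn (fun v => (m v : ℝ)) (offCircles V) := fun q hq =>
    ((continuous_of_discreteTopology (f := fun k : ℤ => (k : ℝ))).continuousAt.comp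
      (hm.continuousAt (notMem_trace_of_mem_offCircles hq))).continuousWithinAt
  have := hcont.aestronglyMeasurable (μ := area) (isOpen_offCircles V).measurableSet
  rwa [Measure.restrict_eq_self_of_ae_mem (ae_mem_offCircles hV)] at this

/-! ### The lamina moment as a multiple of the sum of the normals. -/

lemma integral_coe_sphere : ∫ v : S2, (v : E3) ∂area = 0 := by
  have h := integral_neg_sphere fun v => (v : E3)
  simp only [coe_neg_sphere] at h
  rw [integral_neg] at h
  have h2 : (2 : ℝ) • ∫ v : S2, (v : E3) ∂area = 0 := by
    rw [two_smul]
    nth_rewrite 1 [← h]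
    exact neg_add_cancel _
  exact (smul_eq_zero.1 h2).resolve_left two_ne_zero

/-- The moment of a lamina as a sum over the sides. -/
lemma laminaMoment_eq_sum {V : Fin n → S2} (hV : IsPolygon V) {m : S2 → ℤ}
    (hm : IsLaminaBoundedBy V m) :
    (2 : ℝ) • laminaMoment m = (2 * Real.pi)⁻¹ • ∑ i, subtendMoment (V i) (V (i + 1)) := by
  obtain ⟨k, hk⟩ := exists_defect_eq hV hm
  have hint := hm.integrable hV
  have hint' : Integrable (fun v : S2 => (m (-v) : ℝ) • ((-v : S2) : E3)) area :=
    (measurePreserving_sphereMap (LinearIsometryEquiv.neg ℝ)).integrable_comp_of_integrable hint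
  have hone : Integrable (fun v : S2 => (k : ℝ) • (v : E3)) area :=
    integrable_smul_coe aestronglyMeasurable_const |(k : ℝ)| (ae_of_all _ fun _ => le_rfl)
  have hsum : Integrable (fun v : S2 => (2 * Real.pi)⁻¹ •
      ∑ i, (subtend (V i) (V (i + 1)) v).arg • (v : E3)) area :=
    (integrable_finsetSum Finset.univ fun i _ =>
      integrable_arg_subtend (V i) (V (i + 1))).fun_smul _
  calc (2 : ℝ) • laminaMoment m
      = ∫ v : S2, (m v : ℝ) • (v : E3) + (m (-v) : ℝ) • ((-v : S2) : E3) ∂area := by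
        -- The antipodal map preserves area, so both summands have the same integral.
        rw [integral_add hint hint', integral_neg_sphere fun v => (m v : ℝ) • (v : E3), two_smul]
        rfl
    _ = ∫ v : S2, (k : ℝ) • (v : E3) + (2 * Real.pi)⁻¹ •
          ∑ i, (subtend (V i) (V (i + 1)) v).arg • (v : E3) ∂area := by
        refine integral_congr_ae ?_
        filter_upwards [ae_mem_offCircles hV] with v hv
        rw [← hk v hv, defect, coe_neg_sphere, ← Finset.sum_smul]
        module
    _ = _ := by
        rw [integral_add hone hsum, integral_smul, integral_coe_sphere, smul_zero, zero_add,
          integral_smul, integral_finsetSum _ fun i _ => integrable_arg_subtend _ _]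
        rfl

lemma exists_laminaMoment_eq {V : Fin n → S2} (hV : IsPolygon V) (heq : IsEquilateral V)
    {m : S2 → ℤ} (hm : IsLaminaBoundedBy V m) :
    ∃ κ : ℝ, 0 < κ ∧ laminaMoment m = κ • ∑ i, leftNormal V i := by
  obtain ⟨κ, hκ, h⟩ := exists_subtendMoment_eq _ (hV.inner_sq_lt_one 0)
  have hall : ∀ i, subtendMoment (V i) (V (i + 1)) = κ • leftNormal V i := by
    intro i
    refine h _ _ ?_
    have h1 := congrArg Real.cos (heq i 0)
    rw [sideLength, sideLength, InnerProductGeometry.cos_angle, InnerProductGeometry.cos_angle] at h1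
    simpa [norm_eq_of_mem_sphere] using h1
  have h2 := laminaMoment_eq_sum hV hm
  simp only [hall] at h2
  rw [← Finset.smul_sum, smul_smul] at h2
  have := Real.pi_pos
  refine ⟨2⁻¹ * ((2 * Real.pi)⁻¹ * κ), by positivity, ?_⟩
  rw [mul_smul, ← h2, smul_smul, inv_mul_cancel₀ two_ne_zero, one_smul]

/-! ### Domains bounded by simple polygons. -/

open scoped Classical in
/-- The indicator function of the domain bounded by a simple polygon is a multiplicity function. -/
lemma IsDomainBoundedBy.isLaminaBoundedBy {V : Fin n → S2} (hV : IsPolygon V) (hs : IsSimple V)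
    {U : Set S2} (hU : IsDomainBoundedBy V U) :
    IsLaminaBoundedBy V (fun v => if v ∈ U then 1 else 0) where
  locallyConst p hp := by
    rw [← hU.frontier_eq, frontier, Set.mem_sdiff, not_and_not_right, hU.isOpen.interior_eq] at hp
    by_cases h : p ∈ U
    · filter_upwards [hU.isOpen.mem_nhds h] with q hq
      rw [if_pos hq, if_pos h]
    · filter_upwards [isClosed_closure.isOpen_compl.mem_nhds fun h1 => h (hp h1)] with q hq
      rw [if_neg fun h1 => hq (subset_closure h1), if_neg h]
  jump i p hp hpV _ := by
    -- By simplicity, no other side passes through a point of a side that is not a vertex.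
    have hnet : netMultiplicity V i p = 1 := by
      rw [netMultiplicity, Finset.sum_eq_single i]
      · rw [if_pos hp, sign_pos (real_inner_self_pos.2 (hV.leftNormal_ne_zero i))]
        rfl
      · intro j _ hji
        refine if_neg fun hj => ?_
        rcases hs i j p hji.symm hp hj with ⟨-, h⟩ | ⟨-, h⟩
        exacts [hpV _ h, hpV _ h]
      · exact fun h => (h (Finset.mem_univ i)).elim
    have h := hU.left i p hp hpV
    rw [nhds_prod_eq]
    filter_upwards [h.prod_mk h] with q hq h1 h2
    rw [hnet, if_pos (hq.1.2 h1), if_neg fun h3 => (hq.2.1 h3).not_gt h2, sub_zero]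

open scoped Classical in
lemma domainMoment_eq_laminaMoment {U : Set S2} (hU : IsOpen U) :
    domainMoment U = laminaMoment fun v => if v ∈ U then 1 else 0 := by
  rw [domainMoment, laminaMoment, ← integral_indicator hU.measurableSet]
  congr 1
  ext1 v
  by_cases h : v ∈ U <;> simp [h]

end Polygon

end

end SphericalPolygon

open SphericalPolygon in
theorem mainTheorem11 {n : ℕ} [NeZero n] (V : Fin n → S2) (hV : IsPolygon V)
    (heq : IsEquilateral V) (W : S2) (hW : ∀ i, W ≠ V i) :
    (∀ U : Set S2, IsSimple V → IsDomainBoundedBy V U →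
      (ccmMoment V W = 0 ↔ domainMoment U = 0) ∧ CCM V W = domainCM U) ∧
    (∀ m : S2 → ℤ, IsLaminaBoundedBy V m →
      (ccmMoment V W = 0 ↔ laminaMoment m = 0) ∧ CCM V W = laminaCM m) := by
  classical
  have hlam : ∀ m : S2 → ℤ, IsLaminaBoundedBy V m →
      (ccmMoment V W = 0 ↔ laminaMoment m = 0) ∧ CCM V W = laminaCM m := by
    intro m hm
    obtain ⟨κ, hκ, h⟩ := exists_laminaMoment_eq hV heq hm
    have hC : CCM V W = NormedSpace.normalize (ccmMoment V W) := rfl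
    -- Both moments are positive multiples of the sum of the normals, and positive factors affect
    -- neither vanishing nor normalization.
    rw [hC, laminaCM, h, ccmMoment_eq, NormedSpace.normalize_smul_of_pos hκ,
      NormedSpace.normalize_smul_of_pos one_half_pos, smul_eq_zero_iff_right one_half_pos.ne',
      smul_eq_zero_iff_right hκ.ne']
    exact ⟨Iff.rfl, rfl⟩
  refine ⟨fun U hs hU => ?_, hlam⟩
  rw [domainCM, domainMoment_eq_laminaMoment hU.isOpen]
  exact hlam _ (hU.isLaminaBoundedBy hV hs)
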